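/- Let $q$ be an odd prime power, $h\ge 1$ an odd integer and $n$ an integer with $0<n<3h$ and $\gcd(h,n)=1$, and suppose that $h+n\equiv 0 \pmod 3$ or $q\equiv 1\pmod 3$. Let $u$ be a primitive element of $\mathbb F_{q^{3h}}$, put $v=u^{q^h-1}$, and define on $\mathbb F_{q^{3h}}$ $$x\star y=y^{q^n}x+yx^{q^n}-v\left(y^{q^{h+n}}x^{q^{2h}}+y^{q^{2h}}x^{q^{h+n}}\right).$$ Then $(\mathbb F_{q^{3h}},+,\star)$ is a presemifield (a Zha--Kyureghyan--Wang presemifield), that is, $\star$ is distributive over $+$ on both sides and has no zero divisors, and its middle nucleus and its center both have order $q$. Here the order of the middle nucleus, respectively the center, of a finite presemifield is that of any semifield (presemifield with multiplicative identity) isotopic to it: such semifields exist, and in each of them, $(S,+,\bullet)$, the middle nucleus $\mathbb N_m=\{b : (a\bullet b)\bullet c=a\bullet(b\bullet c)\ \forall a,c\in S\}$ and the center (the set of elements that lie in the left, middle and right nucleus and commute with all elements of $S$) have exactly $q$ elements. Presemifields $(S,+,\star)$ and $(S',+,\star')$ are isotopic if there are additive bijections $g_1,g_2,g_3:S\to S'$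 with $g_1(x)\star' g_2(y)=g_3(x\star y)$ for all $x,y\in S$. -/

import Mathlib

/-- `(S, +, m)` is a presemifield: `m` is distributive on both sides, `S ≠ 0`, and the equations
`a * x = b` and `x * a = b` are uniquely solvable for every `a ≠ 0` (for finite `S` this is the
same as having no zero divisors). -/
structure IsPresemifield {S : Type*} [AddCommGroup S] (m : S → S → S) : Prop where
  finite : Finite S
  nontrivial : Nontrivial S
  left_distrib : ∀ a b c, m a (b + c) = m a b + m a c
  right_distrib : ∀ a b c, m (a + b) c = m a c + m b c
  left_bijective : ∀ a, a ≠ 0 → Function.Bijective (fun x => m a x)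
  right_bijective : ∀ a, a ≠ 0 → Function.Bijective (fun x => m x a)

/-- A semifield is a presemifield with a two-sided multiplicative identity. -/
structure IsSemifield {S : Type*} [AddCommGroup S] (m : S → S → S) : Prop
    extends IsPresemifield m where
  exists_one : ∃ e, ∀ x, m e x = x ∧ m x e = x

/-- Isotopy of `(S, +, m)` and `(S', +, m')`. The additive groups are elementary abelian
`p`-groups, so the invertible `𝔽_p`-linear maps are exactly the additive isomorphisms. -/
def IsIsotopic {S S' : Type*} [AddCommGroup S] [AddCommGroup S']
    (m : S → S → S) (m' : S' → S' → S') : Prop :=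
  ∃ g₁ g₂ g₃ : S ≃+ S', ∀ x y, m' (g₁ x) (g₂ y) = g₃ (m x y)

/-- Left nucleus. -/
def leftNucleus {S : Type*} (m : S → S → S) : Set S :=
  {a | ∀ b c, m (m a b) c = m a (m b c)}

/-- Middle nucleus. -/
def middleNucleus {S : Type*} (m : S → S → S) : Set S :=
  {b | ∀ a c, m (m a b) c = m a (m b c)}

/-- Right nucleus. -/
def rightNucleus {S : Type*} (m : S → S → S) : Set S :=
  {c | ∀ a b, m (m a b) c = m a (m b c)}

/-- Center: the elements of all three nuclei that commute with every element. -/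
def semifieldCenter {S : Type*} (m : S → S → S) : Set S :=
  {a | a ∈ leftNucleus m ∩ middleNucleus m ∩ rightNucleus m ∧ ∀ b, m a b = m b a}

/-- The Zha–Kyureghyan–Wang multiplication
`x ⋆ y = y^(q^n) x + y x^(q^n) - v (y^(q^(h+n)) x^(q^(2h)) + y^(q^(2h)) x^(q^(h+n)))`,
where `v = u^(q^h - 1)`. -/
def zkwMul {F : Type*} [Field F] (q h n : ℕ) (u : F) (x y : F) : F :=
  y ^ q ^ n * x + y * x ^ q ^ n
    - u ^ (q ^ h - 1) *
      (y ^ q ^ (h + n) * x ^ q ^ (2 * h) + y ^ q ^ (2 * h) * x ^ q ^ (h + n))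

/-! Write `θ x = x^(q^h)`, `τ x = x^(q^n)`; then `θ³ = 1` and `u v = θ u`. For `y = x t`, the
equation `x ⋆ y = 0` becomes `w (t + τ t) = θ w (θ τ t + θ² t)` with `w = u x^(q^n + q^h + 1)`. The
arithmetic hypotheses give some `d > 1` dividing `q^n + q^h + 1`, `q^(h+n) - 1` and `q^(2h) + q^h +
1` (`exists_common_divisor`). Then `w` is not a `d`-th power, because `u` is not, whereas every
element fixed by `θ` is one. If `θ t = t`, the relation forces `θ w = w`. Otherwise, eliminating `t`
(`mul_sub_mul_eq_of_cyclic_relation`) shows that `θ² w` is a `θ`-fixed element times `D^(q^(h+n) -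
1)`, with `D = θ w - w`, hence a `d`-th power. Both cases are contradictory.

The middle nucleus of an isotopic semifield corresponds to additive pairs `(A, B)` with `A x ⋆ y = x
⋆ B y`. It is enough to show that each such `A` is multiplication by some `a` with `a^q = a`: these
scalars pass through `⋆`, so they also land in the center
(`ncard_middleNucleus_and_semifieldCenter`). The powers of the Frobenius map `x ↦ x^q` are linearly
independent, so both sides expand with one common coefficient matrix. Each side contains both `A`
and `τ A` (or `B` and `τ B`), so some matrix entries are shifted `τ`-images of others. Together with
the small support of the matrix, this leaves only scalars (`exists_scalars_of_sum_mul_eq`). For `h =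
n = 1` the support is everything, and a norm argument using `3 ≠ 0` replaces it. -/

/-! ### Absence of zero divisors. -/

/-- In a finite field whose order is a power of `q`, raising to the power `q ^ i` is a ring
homomorphism. -/
theorem exists_ringHom_pow {F : Type*} [Field F] [Finite F] {q N : ℕ} (hq : IsPrimePow q)
    (hN : N ≠ 0) (hF : Nat.card F = q ^ N) (i : ℕ) : ∃ φ : F →+* F, ∀ x, φ x = x ^ q ^ i := by
  obtain ⟨p, k, hp, hk, rfl⟩ := hq
  have hp' := Nat.prime_iff.mpr hp
  obtain ⟨c, hc⟩ := CharP.exists F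
  have hc' : c = p := by
    have := Fintype.ofFinite F
    obtain ⟨m, hcp, hm⟩ := FiniteField.card F c
    rw [← Nat.card_eq_fintype_card, hF, ← pow_mul] at hm
    have h1 : p ∣ c ^ (m : ℕ) := hm ▸ dvd_pow_self p (by positivity)
    exact ((Nat.prime_dvd_prime_iff_eq hp' hcp).mp (hp'.dvd_of_dvd_pow h1)).symm
  subst hc'
  have : ExpChar F c := ExpChar.prime hp'
  exact ⟨iterateFrobenius F c (k * i), fun x => by rw [iterateFrobenius_def, pow_mul]⟩

/-- The elimination behind the absence of zero divisors: two field endomorphisms `θ`, `τ` commute,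
`θ` has order dividing three, and `w (t + τ t) = θ w (θ (τ t) + θ² t)`. If `θ t ≠ t`, then `θ² w`
is the quotient of `θ (τ D)` and `D = θ w - w`, up to a factor fixed by `θ`. -/
theorem mul_sub_mul_eq_of_cyclic_relation {F : Type*} [Field F] (θ τ : F →+* F)
    (hθ : ∀ x, θ (θ (θ x)) = x) (hc : ∀ x, θ (τ x) = τ (θ x)) {w t : F}
    (h : w * (t + τ t) = θ w * (θ (τ t) + θ (θ t))) (ht : θ t ≠ t) :
    w * (θ (θ w) - θ w) * τ (θ (θ w) - θ w) =
      θ (θ w) * (θ w - w) * τ (w - θ (θ w)) := by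
  have h1 := congrArg θ h
  have h2 := congrArg θ h1
  have hτ : τ (θ t) - τ t ≠ 0 := by
    rw [← map_sub]; exact (map_ne_zero τ).mpr (sub_ne_zero.mpr ht)
  simp only [map_mul, map_add, hθ, hc] at h h1 h2
  -- The plain sum of the three cyclic images cancels every `τ` term; the weights `θ² w`, `w`, `θ w`
  -- in `e2` cancel every term without `τ`. Comparing `τ e1` with `e2` then eliminates `t`.
  have e1 : (θ t - t) * (w - θ (θ w)) = (θ (θ t) - θ t) * (θ (θ w) - θ w) := by
    linear_combination -h - h1 - h2
  have e2 : (τ (θ t) - τ t) * (w * (θ (θ w) - θ w)) =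
      (τ (θ (θ t)) - τ (θ t)) * (θ (θ w) * (θ w - w)) := by
    linear_combination -(θ (θ w)) * h - w * h1 - θ w * h2
  have e3 := congrArg τ e1
  simp only [map_mul] at e3
  rw [map_sub τ (θ t), map_sub τ (θ (θ t))] at e3
  apply mul_left_cancel₀ hτ
  linear_combination (τ (θ (θ w) - θ w)) * e2 - (θ (θ w) * (θ w - w)) * e3

/-- If `3 ∣ h + n`, coprimality makes `h` and `n` the residues 1 and 2 modulo 3 in some order, and
`d = q² + q + 1` works since `q³ ≡ 1` modulo it. If `q ≡ 1` modulo 3, take `d = 3`. -/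
theorem exists_common_divisor {q h n : ℕ} (hcop : Nat.Coprime h n)
    (hcong : 3 ∣ h + n ∨ q ≡ 1 [MOD 3]) (hq : 1 < q) :
    ∃ d, 1 < d ∧ d ∣ q ^ n + q ^ h + 1 ∧ d ∣ q ^ (h + n) - 1 ∧ d ∣ q ^ (2 * h) + q ^ h + 1 := by
  rcases hcong with h3 | h1
  · have hd : q ^ 3 ≡ 1 [MOD q ^ 2 + q + 1] := by
      refine ((Nat.modEq_iff_dvd' (Nat.one_le_pow _ _ (by omega))).mpr ⟨q - 1, ?_⟩).symm
      obtain ⟨r, rfl⟩ : ∃ r, q = r + 1 := ⟨q - 1, by omega⟩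
      rw [Nat.add_sub_cancel, Nat.sub_eq_iff_eq_add (Nat.one_le_pow _ _ (by omega))]
      ring
    have key : ∀ a b, q ^ (3 * a + b) ≡ q ^ b [MOD q ^ 2 + q + 1] := fun a b => by
      rw [pow_add, pow_mul]
      simpa using (hd.pow a).mul_right (q ^ b)
    have hself : q ^ 2 + q + 1 ≡ 0 [MOD q ^ 2 + q + 1] := by simp [Nat.ModEq]
    have hn3 : ¬ 3 ∣ h := fun hh => by
      have : 3 ∣ Nat.gcd h n := Nat.dvd_gcd hh ((Nat.dvd_add_right hh).mp h3)
      rw [hcop] at this; omega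
    refine ⟨q ^ 2 + q + 1, by nlinarith, ?_, ?_, ?_⟩
    · rw [← Nat.modEq_zero_iff_dvd]
      obtain ⟨h12 | h12, h12'⟩ : (h % 3 = 1 ∨ h % 3 = 2) ∧ (h % 3 + n % 3 = 3) := by omega
      · have e1 := key (n / 3) 2
        have e2 := key (h / 3) 1
        rw [show 3 * (n / 3) + 2 = n by omega] at e1
        rw [show 3 * (h / 3) + 1 = h by omega, pow_one] at e2
        exact ((e1.add e2).add_right 1).trans hself
      · have e1 := key (n / 3) 1
        have e2 := key (h / 3) 2
        rw [show 3 * (n / 3) + 1 = n by omega, pow_one] at e1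
        rw [show 3 * (h / 3) + 2 = h by omega] at e2
        refine ((e1.add e2).add_right 1).trans ?_
        rwa [add_comm q]
    · obtain ⟨m, hm⟩ := h3
      refine (Nat.modEq_iff_dvd' (Nat.one_le_pow _ _ (by omega))).mp ?_
      simpa [hm] using (key m 0).symm
    · rw [← Nat.modEq_zero_iff_dvd]
      obtain h12 | h12 : h % 3 = 1 ∨ h % 3 = 2 := by omega
      · have e1 := key (2 * h / 3) 2
        have e2 := key (h / 3) 1
        rw [show 3 * (2 * h / 3) + 2 = 2 * h by omega] at e1
        rw [show 3 * (h / 3) + 1 = h by omega, pow_one] at e2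
        exact ((e1.add e2).add_right 1).trans hself
      · have e1 := key (2 * h / 3) 1
        have e2 := key (h / 3) 2
        rw [show 3 * (2 * h / 3) + 1 = 2 * h by omega, pow_one] at e1
        rw [show 3 * (h / 3) + 2 = h by omega] at e2
        refine ((e1.add e2).add_right 1).trans ?_
        rwa [add_comm q]
  · have key : ∀ a, q ^ a ≡ 1 [MOD 3] := fun a => by simpa using h1.pow a
    refine ⟨3, by norm_num, ?_, ?_, ?_⟩
    · rw [← Nat.modEq_zero_iff_dvd]
      exact (((key n).add (key h)).add_right 1).trans rfl
    · exact (Nat.modEq_iff_dvd' (Nat.one_le_pow _ _ (by omega))).mp (key _).symm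
    · rw [← Nat.modEq_zero_iff_dvd]
      exact (((key _).add (key h)).add_right 1).trans rfl

theorem exists_pow_eq_of_orderOf {F : Type*} [Field F] [Finite F] {u : F}
    (hu : orderOf u = Nat.card F - 1) {z : F} (hz : z ≠ 0) : ∃ j, u ^ j = z := by
  have := Fintype.ofFinite F
  have hc : 1 < Nat.card F := Finite.one_lt_card
  have : NeZero (Nat.card F - 1) := ⟨by omega⟩
  have hpr : IsPrimitiveRoot u (Nat.card F - 1) := hu ▸ IsPrimitiveRoot.orderOf u
  obtain ⟨j, -, hj⟩ := hpr.eq_pow_of_pow_eq_one (ξ := z)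
    (by rw [Nat.card_eq_fintype_card]; exact FiniteField.pow_card_sub_one_eq_one z hz)
  exact ⟨j, hj⟩

/-- In a cyclic group of order `e * c`, the `e`-th roots of unity are the `c`-th powers. Used with
`e = q^h - 1` to make the elements fixed by `θ` into `d`-th powers. -/
theorem exists_pow_eq_of_pow_eq_one {F : Type*} [Field F] [Finite F] {u : F}
    (hu : orderOf u = Nat.card F - 1) {z : F} {d e c : ℕ} (hec : e * c = Nat.card F - 1)
    (hdc : d ∣ c) (hz : z ^ e = 1) : ∃ r : F, r ^ d = z := by
  have hc : 1 < Nat.card F := Finite.one_lt_card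
  have he : e ≠ 0 := by rintro rfl; omega
  obtain ⟨j, rfl⟩ := exists_pow_eq_of_orderOf hu (z := z) (by
    rintro rfl; rw [zero_pow he] at hz; exact zero_ne_one hz)
  rw [← pow_mul] at hz
  have h1 := orderOf_dvd_of_pow_eq_one hz
  rw [hu, ← hec, mul_comm j e] at h1
  obtain ⟨m, rfl⟩ := hdc.trans (Nat.dvd_of_mul_dvd_mul_left (by omega) h1)
  exact ⟨u ^ m, by rw [← pow_mul, mul_comm]⟩

theorem not_exists_pow_eq_of_orderOf {F : Type*} [Field F] [Finite F] {u : F}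
    (hu : orderOf u = Nat.card F - 1) {d : ℕ} (hd : 1 < d) (hdc : d ∣ Nat.card F - 1) (r : F) :
    r ^ d ≠ u := by
  have := Fintype.ofFinite F
  have hc : 1 < Nat.card F := Finite.one_lt_card
  rintro rfl
  obtain ⟨m, hm⟩ := hdc
  have hr : r ≠ 0 := by
    rintro rfl
    rw [zero_pow (by omega), orderOf_zero] at hu; omega
  have h1 : (r ^ d) ^ m = 1 := by
    rw [← pow_mul, ← hm, Nat.card_eq_fintype_card]
    exact FiniteField.pow_card_sub_one_eq_one r hr
  have h2 := orderOf_dvd_of_pow_eq_one h1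
  rw [hu] at h2
  have h3 : 0 < m := Nat.pos_of_ne_zero (by rintro rfl; omega)
  have := Nat.le_of_dvd h3 h2
  rw [hm] at this
  nlinarith

theorem two_ne_zero_of_odd_card {F : Type*} [Field F] [Finite F] (hF : Odd (Nat.card F)) :
    (2 : F) ≠ 0 := by
  intro h
  have h1 : addOrderOf (1 : F) ∣ 2 := addOrderOf_dvd_of_nsmul_eq_zero (by simpa using h)
  have h2 : addOrderOf (1 : F) ∣ Nat.card F := addOrderOf_dvd_natCard 1
  rcases (Nat.dvd_prime Nat.prime_two).mp h1 with h3 | h3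
  · exact one_ne_zero (AddMonoid.addOrderOf_eq_one_iff.mp h3)
  · rw [h3] at h2
    exact (Nat.not_even_iff_odd.mpr hF) (even_iff_two_dvd.mpr h2)

theorem pow_pow_card_exponent {F : Type*} [Field F] [Finite F] {q N : ℕ}
    (hF : Nat.card F = q ^ N) (x : F) : x ^ q ^ N = x := by
  have := Fintype.ofFinite F
  rw [← hF, Nat.card_eq_fintype_card, FiniteField.pow_card]

/-- If `τ t = -t`, applying `τ` an odd number `N` of times gives `-t`; but `τ^N` is the identity,
and the characteristic is odd. -/
theorem add_pow_pow_ne_zero {F : Type*} [Field F] [Finite F] {q N : ℕ} (hq : Odd q) (hN : Odd N)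
    (hF : Nat.card F = q ^ N) (n : ℕ) {t : F} (ht : t ≠ 0) : t + t ^ q ^ n ≠ 0 := by
  intro h
  have h1 : t ^ q ^ n = -t := by linear_combination h
  have key : ∀ j, t ^ (q ^ n) ^ j = (-1) ^ j * t := by
    intro j
    induction j with
    | zero => simp
    | succ j ih =>
      rw [pow_succ, pow_mul, ih, mul_pow, h1, pow_succ (-1 : F), ← pow_mul, mul_comm j, pow_mul,
        Odd.neg_one_pow (hq.pow)]
      ring
  have h2 := key N
  rw [← pow_mul, mul_comm n, pow_mul, hN.neg_one_pow] at h2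
  have h3 : ∀ j, t ^ (q ^ N) ^ j = t := by
    intro j
    induction j with
    | zero => simp
    | succ j ih => rw [pow_succ, pow_mul, ih, pow_pow_card_exponent hF]
  rw [h3] at h2
  have h4 : (2 : F) * t = 0 := by linear_combination h2
  exact (mul_ne_zero (two_ne_zero_of_odd_card (hF ▸ hq.pow)) ht) h4

theorem zkwMul_ne_zero {F : Type*} [Field F] [Finite F] {q h n : ℕ}
    (hq : IsPrimePow q) (hq_odd : Odd q) (hh : Odd h) (hcop : Nat.Coprime h n)
    (hcong : 3 ∣ h + n ∨ q ≡ 1 [MOD 3]) (hF : Nat.card F = q ^ (3 * h))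
    {u : F} (hu : orderOf u = q ^ (3 * h) - 1) {x y : F} (hx : x ≠ 0) (hy : y ≠ 0) :
    zkwMul q h n u x y ≠ 0 := by
  have hh0 := hh.pos
  have hN : 3 * h ≠ 0 := by omega
  obtain ⟨θ, hθ⟩ := exists_ringHom_pow hq hN hF h
  obtain ⟨τ, hτ⟩ := exists_ringHom_pow hq hN hF n
  have hθ3 : ∀ x, θ (θ (θ x)) = x := fun x => by
    rw [hθ, hθ, hθ, ← pow_mul, ← pow_mul, ← pow_add, ← pow_add,
      show h + (h + h) = 3 * h by ring, pow_pow_card_exponent hF]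
  have hc : ∀ x, θ (τ x) = τ (θ x) := fun x => by
    rw [hθ, hθ, hτ, hτ, ← pow_mul, ← pow_mul, mul_comm]
  have hθθ : ∀ x : F, x ^ q ^ (2 * h) = θ (θ x) := fun x => by
    rw [hθ, hθ, ← pow_mul, ← pow_add, two_mul]
  have hθτ : ∀ x : F, x ^ q ^ (h + n) = θ (τ x) := fun x => by
    rw [hθ, hτ, ← pow_mul, ← pow_add, add_comm]
  have hF' : orderOf u = Nat.card F - 1 := by rw [hu, hF]
  have hcard : 1 < Nat.card F := Finite.one_lt_card
  have hu0 : u ≠ 0 := by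
    rintro rfl
    rw [orderOf_zero] at hF'; omega
  have huθ : u * u ^ (q ^ h - 1) = θ u := by
    rw [hθ, mul_pow_sub_one (pow_pos hq.pos h).ne']
  intro h0
  obtain ⟨t, rfl⟩ : ∃ t, y = x * t := ⟨y / x, by field_simp⟩
  have ht0 : t ≠ 0 := right_ne_zero_of_mul hy
  rw [zkwMul] at h0
  simp only [hθθ, hθτ, ← hτ, map_mul] at h0
  obtain ⟨d, hd1, hd2, hd3, hd4⟩ := exists_common_divisor hcop hcong hq.one_lt
  have hdvd : (q ^ h - 1) * (q ^ (2 * h) + q ^ h + 1) = Nat.card F - 1 := by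
    rw [hF]
    obtain ⟨Q, hQ⟩ : ∃ Q, q ^ h = Q + 1 := ⟨q ^ h - 1, by have := pow_pos hq.pos h; omega⟩
    rw [mul_comm 2, mul_comm 3, pow_mul, pow_mul, hQ, Nat.add_sub_cancel]
    apply Nat.eq_sub_of_add_eq
    ring
  obtain ⟨a, ha⟩ := hd2
  obtain ⟨b, hb⟩ := hd3
  set w := u * (τ x * θ x * x) with hw
  have hwx : w = u * (x ^ a) ^ d := by
    rw [hw, hτ, hθ, ← pow_mul, mul_comm a, ← ha, pow_add, pow_add, pow_one]
  have hw0 : w ≠ 0 := by rw [hwx]; positivity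
  have hrel : w * (t + τ t) = θ w * (θ (τ t) + θ (θ t)) := by
    simp only [hw, map_mul, hc] at h0 ⊢
    linear_combination (u * θ x) * h0 + (τ (θ x) * θ (θ x) * θ x * (τ (θ t) + θ (θ t))) * huθ
  have hnot : ∀ r : F, r ^ d ≠ w := by
    intro r hr
    refine not_exists_pow_eq_of_orderOf hF' hd1 (hdvd ▸ hd4.mul_left _) (r / x ^ a) ?_
    rw [div_pow, hr, hwx]
    field_simp
  have hfix : ∀ k, k ≠ 0 → θ k = k → ∃ r : F, r ^ d = k := by
    intro k hk hkθ
    refine exists_pow_eq_of_pow_eq_one hF' hdvd hd4 ?_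
    rw [hθ] at hkθ
    apply mul_left_cancel₀ hk
    rw [mul_pow_sub_one (pow_pos hq.pos h).ne', hkθ, mul_one]
  have hwθ : θ w - w ≠ 0 := fun h1 => by
    obtain ⟨r, hr⟩ := hfix w hw0 (sub_eq_zero.mp h1)
    exact hnot r hr
  by_cases ht : θ t = t
  · rw [hc, ht, ht, add_comm (τ t)] at hrel
    have hne : t + τ t ≠ 0 := by
      rw [hτ]
      exact add_pow_pow_ne_zero hq_odd (Odd.mul (by decide) hh) hF n ht0
    exact hwθ (sub_eq_zero.mpr (mul_right_cancel₀ hne hrel).symm)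
  · have key := mul_sub_mul_eq_of_cyclic_relation θ τ hθ3 hc hrel ht
    have hD1 : θ (θ w) - θ w ≠ 0 := by rw [← map_sub]; exact (map_ne_zero θ).mpr hwθ
    have hD2 : w - θ (θ w) ≠ 0 := by
      have := (map_ne_zero θ).mpr hD1
      rwa [map_sub, hθ3] at this
    have hτ1 := (map_ne_zero τ).mpr hD1
    have hτ2 := (map_ne_zero τ).mpr hD2
    have hw2 : θ (θ w) ≠ 0 := (map_ne_zero θ).mpr ((map_ne_zero θ).mpr hw0)
    -- The elimination identity says exactly that this quotient is fixed by `θ`.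
    obtain ⟨r, hr⟩ := hfix (θ (θ w) * (θ w - w) / τ (θ (θ w) - θ w))
      (div_ne_zero (mul_ne_zero hw2 hwθ) hτ1) (by
        rw [map_div₀, map_mul, map_sub, hθ3, hc, map_sub θ (θ (θ w)), hθ3,
          div_eq_div_iff hτ2 hτ1, key])
    have hτD : τ (θ (θ w) - θ w) = ((θ w - w) ^ b) ^ d * (θ w - w) := by
      rw [← map_sub θ, ← hc, ← hθτ, ← pow_mul, mul_comm b, ← hb, mul_comm,
        mul_pow_sub_one (pow_pos hq.pos _).ne']
    refine hnot (θ (r * (θ w - w) ^ b)) ?_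
    have : θ (θ w) = (r * (θ w - w) ^ b) ^ d := by
      rw [mul_pow, hr, hτD]
      field_simp
    rw [← map_pow, ← this, hθ3]

/-! ### Presemifield axioms and an isotopic semifield. -/

theorem zkwMul_comm {F : Type*} [Field F] (q h n : ℕ) (u x y : F) :
    zkwMul q h n u x y = zkwMul q h n u y x := by
  simp only [zkwMul]; ring

theorem zkwMul_add_right {F : Type*} [Field F] [Finite F] {q h n N : ℕ} (hq : IsPrimePow q)
    (hN : N ≠ 0) (hF : Nat.card F = q ^ N) (u x y z : F) :
    zkwMul q h n u x (y + z) = zkwMul q h n u x y + zkwMul q h n u x z := by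
  have key : ∀ i, (y + z) ^ q ^ i = y ^ q ^ i + z ^ q ^ i := fun i => by
    obtain ⟨φ, hφ⟩ := exists_ringHom_pow hq hN hF i
    simp only [← hφ, map_add]
  simp only [zkwMul, key]; ring

theorem isPresemifield_zkwMul {F : Type*} [Field F] [Finite F] {q h n : ℕ}
    (hq : IsPrimePow q) (hq_odd : Odd q) (hh : Odd h) (hcop : Nat.Coprime h n)
    (hcong : 3 ∣ h + n ∨ q ≡ 1 [MOD 3]) (hF : Nat.card F = q ^ (3 * h))
    {u : F} (hu : orderOf u = q ^ (3 * h) - 1) : IsPresemifield (zkwMul q h n u) := by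
  have hadd := fun x y z => zkwMul_add_right (h := h) (n := n) hq
    (by have := hh.pos; omega) hF u x y z
  have hbij : ∀ a : F, a ≠ 0 → Function.Bijective (fun x => zkwMul q h n u a x) := by
    intro a ha
    rw [← Finite.injective_iff_bijective]
    refine (injective_iff_map_eq_zero
      (AddMonoidHom.mk' (fun x => zkwMul q h n u a x) (hadd a))).mpr fun x hx => ?_
    by_contra hx0
    exact zkwMul_ne_zero hq hq_odd hh hcop hcong hF hu ha hx0 hx
  refine ⟨inferInstance, inferInstance, hadd, fun a b c => ?_, hbij, fun a ha => ?_⟩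
  · rw [zkwMul_comm, hadd, zkwMul_comm, zkwMul_comm _ _ _ _ c b]
  · simpa only [zkwMul_comm q h n u a] using hbij a ha

/-- Kaplansky's construction: every presemifield is isotopic to a semifield on the same set. -/
theorem IsPresemifield.exists_isSemifield_isIsotopic {S : Type*} [AddCommGroup S]
    {m : S → S → S} (hm : IsPresemifield m) :
    ∃ m' : S → S → S, IsSemifield m' ∧ IsIsotopic m m' := by
  have := hm.nontrivial
  obtain ⟨e, he⟩ := exists_ne (0 : S)
  let R : S ≃+ S := AddEquiv.ofBijective
    (AddMonoidHom.mk' (fun x => m x e) fun x y => hm.right_distrib x y e) (hm.right_bijective e he)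
  let L : S ≃+ S := AddEquiv.ofBijective
    (AddMonoidHom.mk' (fun x => m e x) fun x y => hm.left_distrib e x y) (hm.left_bijective e he)
  -- The new product satisfies `(x * e) • (e * y) = x * y`, so `e * e` is its identity.
  refine ⟨fun a b => m (R.symm a) (L.symm b), ⟨⟨hm.finite, hm.nontrivial, ?_, ?_, ?_, ?_⟩, ?_⟩,
    R, L, AddEquiv.refl S, fun x y => by simp⟩
  · intro a b c; simp only [map_add, hm.left_distrib]
  · intro a b c; simp only [map_add, hm.right_distrib]
  · intro a ha
    exact (hm.left_bijective _ (by simpa using ha)).comp L.symm.bijective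
  · intro a ha
    exact (hm.right_bijective _ (by simpa using ha)).comp R.symm.bijective
  · have hR : R.symm (m e e) = e := R.symm_apply_apply e
    have hL : L.symm (m e e) = e := L.symm_apply_apply e
    refine ⟨m e e, fun x => ⟨?_, ?_⟩⟩
    · rw [hR]; exact L.apply_symm_apply x
    · rw [hL]; exact R.apply_symm_apply x

/-! ### Middle nucleus and center in terms of scalars. -/

/-- If the pairs `(A, B)` of additive maps with `A x * y = x * B y` are exactly the scalings by a
set `K` of elements over which the presemifield is bilinear, then `K` gives the middle nucleus and
the center of each isotopic semifield. -/
theorem ncard_middleNucleus_and_semifieldCenter {F : Type*} {S : Type*} [Field F] [AddCommGroup S]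
    {μ : F → F → F} {m : S → S → S} (hm : IsSemifield m) (hiso : IsIsotopic μ m) {K : Set F}
    (hKl : ∀ a ∈ K, ∀ x y, μ (a * x) y = a * μ x y)
    (hKr : ∀ a ∈ K, ∀ x y, μ x (a * y) = a * μ x y)
    (hK : ∀ A B : F →+ F, (∀ x y, μ (A x) y = μ x (B y)) → ∃ a ∈ K, ∀ x, A x = a * x) :
    (middleNucleus m).ncard = K.ncard ∧ (semifieldCenter m).ncard = K.ncard := by
  obtain ⟨g₁, g₂, g₃, hg⟩ := hiso
  obtain ⟨e, he⟩ := hm.exists_one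
  have := hm.nontrivial
  have he0 : e ≠ 0 := by
    rintro rfl
    obtain ⟨x, hx⟩ := exists_ne (0 : S)
    have h0 : m 0 x + m 0 x = m 0 x := by rw [← hm.right_distrib, add_zero]
    rw [(he x).1] at h0
    exact hx (add_eq_left.mp h0)
  let ι : F → S := fun a => g₁ (a * g₁.symm e)
  have hι : Function.Injective ι := fun a b hab =>
    mul_right_cancel₀ (by simpa using he0) (g₁.injective hab)
  have hmid : middleNucleus m ⊆ ι '' K := by
    intro b hb
    let Rb : S →+ S := AddMonoidHom.mk' (fun x => m x b) fun x y => hm.right_distrib x y b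
    let Lb : S →+ S := AddMonoidHom.mk' (fun x => m b x) fun x y => hm.left_distrib b x y
    -- Membership of `b` in the middle nucleus, pulled back through the isotopy, says that right and
    -- left multiplication by `b` form such a pair.
    obtain ⟨a, ha, hA⟩ := hK ((g₁.symm.toAddMonoidHom.comp Rb).comp g₁.toAddMonoidHom)
      ((g₂.symm.toAddMonoidHom.comp Lb).comp g₂.toAddMonoidHom) fun x y => by
        apply g₃.injective
        rw [← hg, ← hg]
        simpa [Rb, Lb] using hb (g₁ x) (g₂ y)
    refine ⟨a, ha, ?_⟩
    change g₁ (a * g₁.symm e) = b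
    rw [← hA]
    simpa [Rb] using (he b).1
  have hcen : ι '' K ⊆ semifieldCenter m := by
    rintro _ ⟨a, ha, rfl⟩
    -- Scaling by `a`, transported by `g₃`. The identity element forces the transports by `g₁` and
    -- `g₂` to coincide with it.
    let σ : S → S := fun s => g₃ (a * g₃.symm s)
    have h1 : ∀ x y, m (g₁ (a * g₁.symm x)) y = σ (m x y) := by
      intro x y
      have := hg (a * g₁.symm x) (g₂.symm y)
      rw [hKl a ha, ← g₃.symm_apply_apply (μ _ _), ← hg] at this
      simpa [σ] using this
    have h2 : ∀ x y, m x (g₂ (a * g₂.symm y)) = σ (m x y) := by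
      intro x y
      have := hg (g₁.symm x) (a * g₂.symm y)
      rw [hKr a ha, ← g₃.symm_apply_apply (μ _ _), ← hg] at this
      simpa [σ] using this
    have h1' : ∀ x, g₁ (a * g₁.symm x) = σ x := fun x => by
      rw [← (he (g₁ _)).2, h1, (he x).2]
    have h2' : ∀ x, g₂ (a * g₂.symm x) = σ x := fun x => by
      rw [← (he (g₂ _)).1, h2, (he x).1]
    simp only [h1'] at h1
    simp only [h2'] at h2
    have hb : ι a = σ e := h1' e
    rw [hb]
    have hl : ∀ x, m (σ e) x = σ x := fun x => by rw [h1, (he x).1]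
    have hr : ∀ x, m x (σ e) = σ x := fun x => by rw [h2, (he x).2]
    refine ⟨⟨⟨fun b c => ?_, fun b c => ?_⟩, fun b c => ?_⟩, fun b => ?_⟩
    · rw [hl, hl, h1]
    · rw [hl, hr, h1, h2]
    · rw [hr, hr, h2]
    · rw [hl, hr]
  have hsub : semifieldCenter m ⊆ middleNucleus m := fun b hb => hb.1.1.2
  have e1 : middleNucleus m = ι '' K := hmid.antisymm (hcen.trans hsub)
  have e2 : semifieldCenter m = ι '' K := (hsub.trans hmid).antisymm hcen
  rw [e1, e2, Set.ncard_image_of_injective _ hι]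
  exact ⟨rfl, rfl⟩

/-- The solutions are `0` and the `(q - 1)`-th roots of unity, all of which are present because a
power of `u` is a primitive one. -/
theorem ncard_setOf_pow_eq_self {F : Type*} [Field F] [Finite F] {q N : ℕ} (hq : 1 < q)
    (hN : N ≠ 0) {u : F} (hu : orderOf u = q ^ N - 1) :
    {a : F | a ^ q = a}.ncard = q := by
  obtain ⟨c, hc⟩ : q - 1 ∣ q ^ N - 1 := Nat.sub_one_dvd_pow_sub_one q N
  have hcard : 1 < q ^ N := Nat.one_lt_pow hN hq
  have hu1 : IsPrimitiveRoot u (q ^ N - 1) := hu ▸ IsPrimitiveRoot.orderOf u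
  have hpr : IsPrimitiveRoot (u ^ c) (q - 1) := hu1.pow (by omega) (by rw [hc, mul_comm])
  have hset : {a : F | a ^ q = a} =
      insert 0 ((Polynomial.nthRootsFinset (q - 1) (1 : F) : Finset F) : Set F) := by
    ext a
    simp only [Set.mem_ofPred_eq, Set.mem_insert_iff, Finset.mem_coe,
      Polynomial.mem_nthRootsFinset (show 0 < q - 1 by omega)]
    by_cases ha : a = 0
    · simp [ha, (show q ≠ 0 by omega)]
    · rw [← mul_pow_sub_one (show q ≠ 0 by omega)]
      simp [ha]
  rw [hset, Set.ncard_insert_of_notMem, Set.ncard_coe_finset, hpr.card_nthRootsFinset]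
  · omega
  · simp only [Finset.mem_coe, Polynomial.mem_nthRootsFinset (show 0 < q - 1 by omega)]
    simp [(show q - 1 ≠ 0 by omega)]

/-! ### Coefficient comparison along powers of Frobenius. -/

/-- Comparison of coefficients in an identity between two expansions of a function of two
variables along linearly independent functions. -/
theorem LinearIndependent.exists_coeff_of_sum_mul_eq {F X ι : Type*} [Field F] [Fintype ι]
    [DecidableEq ι] {f : ι → X → F} (hf : LinearIndependent F f) {L M : ι → X → F}
    (h : ∀ x y, ∑ j, L j x * f j y = ∑ i, M i y * f i x) :
    ∃ C : ι → ι → F, (∀ j x, L j x = ∑ i, C i j * f i x) ∧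
      ∀ i y, M i y = ∑ j, C i j * f j y := by
  have huniq : ∀ c : ι → F, (∀ x, ∑ i, c i * f i x = 0) → ∀ i, c i = 0 := fun c hc =>
    Fintype.linearIndependent_iff.mp hf c (by ext x; simpa using hc x)
  -- A functional vanishing on all evaluation vectors would be a linear relation among the `f k`.
  -- Hence some finite combination `c j` of points is dual to `f j`, and evaluating `h` along it
  -- isolates `L j`.
  have hspan : Submodule.span F (Set.range fun y => fun k => f k y) = ⊤ := by
    by_contra hne
    obtain ⟨φ, hφ0, hφ⟩ := Submodule.exists_le_ker_of_lt_top _ (lt_top_iff_ne_top.mpr hne)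
    apply hφ0
    have h1 := huniq (fun k => φ (Pi.single k 1)) fun y => by
      have h2 : φ (fun k => f k y) = 0 := hφ (Submodule.subset_span ⟨y, rfl⟩)
      rw [LinearMap.pi_apply_eq_sum_univ φ] at h2
      rw [← h2]
      refine Finset.sum_congr rfl fun k _ => ?_
      rw [smul_eq_mul, mul_comm]
      congr 2
      ext j
      simp [Pi.single_apply, eq_comm]
    refine LinearMap.pi_ext' fun k => LinearMap.ext_ring ?_
    simpa using h1 k
  have hdual : ∀ j, ∃ c : X →₀ F, (c.sum fun y a => a • fun k => f k y) = Pi.single j 1 := fun j =>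
    Finsupp.mem_span_range_iff_exists_finsupp.mp (hspan ▸ Submodule.mem_top)
  choose c hc using hdual
  have hL : ∀ j x, L j x = ∑ i, ((c j).sum fun y a => a * M i y) * f i x := by
    intro j x
    have h1 : ∀ k, ((c j).sum fun y a => a * f k y) = if k = j then 1 else 0 := fun k => by
      have := congrFun (hc j) k
      simpa [Finsupp.sum, Finset.sum_apply, Pi.single_apply] using this
    calc L j x = ∑ k, L k x * ((c j).sum fun y a => a * f k y) := by simp [h1]
      _ = (c j).sum fun y a => a * ∑ k, L k x * f k y := by
        simp only [Finsupp.sum, Finset.mul_sum]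
        rw [Finset.sum_comm]
        exact Finset.sum_congr rfl fun _ _ => Finset.sum_congr rfl fun _ _ => by ring
      _ = (c j).sum fun y a => a * ∑ i, M i y * f i x := by simp only [h]
      _ = _ := by
        simp only [Finsupp.sum, Finset.mul_sum, Finset.sum_mul]
        rw [Finset.sum_comm]
        exact Finset.sum_congr rfl fun _ _ => Finset.sum_congr rfl fun _ _ => by ring
  refine ⟨_, hL, fun i y => ?_⟩
  refine sub_eq_zero.mp (huniq (fun i => M i y - ∑ j, ((c j).sum fun y a => a * M i y) * f j y)
    (fun x => ?_) i)
  simp only [sub_mul, Finset.sum_sub_distrib, ← h x y, hL]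
  rw [sub_eq_zero]
  simp only [Finset.sum_mul]
  rw [Finset.sum_comm]
  exact Finset.sum_congr rfl fun _ _ => Finset.sum_congr rfl fun _ _ => by ring

/-- The powers of the `q`-th power map on a field with `q ^ N` elements, indexed by `ZMod N`, are
linearly independent field endomorphisms. -/
theorem exists_zmod_ringHom_pow {F : Type*} [Field F] [Finite F] {q N : ℕ} [NeZero N]
    (hq : IsPrimePow q) (hq2 : 2 < q) (hF : Nat.card F = q ^ N) {u : F}
    (hu : orderOf u = q ^ N - 1) :
    ∃ σ : ZMod N → F →+* F, (∀ (i : ℕ) x, σ i x = x ^ q ^ i) ∧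
      (∀ i j x, σ i (σ j x) = σ (i + j) x) ∧ LinearIndependent F (fun i x => σ i x) := by
  have hN : N ≠ 0 := NeZero.ne N
  choose φ hφ using exists_ringHom_pow (F := F) hq hN hF
  have hadd : ∀ i j x, φ i (φ j x) = φ (i + j) x := fun i j x => by
    rw [hφ, hφ, hφ, ← pow_mul, ← pow_add, add_comm]
  have hper : ∀ k i x, φ (i + N * k) x = φ i x := by
    intro k i x
    induction k with
    | zero => rfl
    | succ k ih =>
      rw [mul_add_one, ← add_assoc, ← hadd, hφ N, pow_pow_card_exponent hF, ih]
  have hmod : ∀ i x, φ (i % N) x = φ i x := fun i x => by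
    conv_rhs => rw [← Nat.mod_add_div i N, hper]
  refine ⟨fun i => φ i.val, fun i x => ?_, fun i j x => ?_, ?_⟩
  · change φ _ x = _
    rw [ZMod.val_natCast, hmod, hφ]
  · change φ _ (φ _ x) = φ _ x
    rw [hadd, ZMod.val_add, hmod]
  · have hinj : Function.Injective fun i : ZMod N => (φ i.val : F →* F) := by
      intro i j hij
      have h1 : u ^ q ^ i.val = u ^ q ^ j.val := by
        rw [← hφ, ← hφ]; exact DFunLike.congr_fun hij u
      have hlt : ∀ i : ZMod N, q ^ i.val < orderOf u := fun i => by
        have h2 : q ^ i.val ≤ q ^ (N - 1) :=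
          Nat.pow_le_pow_right (by omega) (by have := i.val_lt; omega)
        have h3 : q ^ N = q ^ (N - 1) * q := (pow_sub_one_mul hN q).symm
        have h4 : 0 < q ^ (N - 1) := by positivity
        rw [hu, h3]
        have : q ^ (N - 1) * 3 ≤ q ^ (N - 1) * q := Nat.mul_le_mul_left _ hq2
        omega
      exact ZMod.val_injective N (Nat.pow_right_injective (by omega)
        (pow_injOn_Iio_orderOf (hlt i) (hlt j) h1))
    exact (linearIndependent_monoidHom F F).comp _ hinj

section Coefficients

variable {F G : Type*} [Field F] [Fintype G] {σ : G → F →+* F}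

theorem coeff_unique (hli : LinearIndependent F (fun i x => σ i x)) {c d : G → F}
    (h : ∀ x, ∑ i, c i * σ i x = ∑ i, d i * σ i x) (i : G) : c i = d i := by
  refine sub_eq_zero.mp (Fintype.linearIndependent_iff.mp hli (fun i => c i - d i) ?_ i)
  ext x
  simp [sub_mul, h x]

theorem coeff_eq_zero (hli : LinearIndependent F (fun i x => σ i x)) {c : G → F}
    (h : ∀ x, ∑ i, c i * σ i x = 0) (i : G) : c i = 0 :=
  coeff_unique hli (d := 0) (by simpa using h) i

variable [AddCommGroup G]

theorem coeff_shift (hli : LinearIndependent F (fun i x => σ i x))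
    (hσ : ∀ i j x, σ i (σ j x) = σ (i + j) x) {A : F → F} {c d : G → F} {k : F} {m : G}
    (hA : ∀ x, A x = ∑ i, c i * σ i x) (h : ∀ x, k * σ m (A x) = ∑ i, d i * σ i x) (i : G) :
    d (i + m) = k * σ m (c i) := by
  refine (coeff_unique hli (c := fun i => k * σ m (c (i - m))) (fun x => ?_) (i + m)).symm.trans
    (by simp)
  rw [← h, hA, map_sum, Finset.mul_sum]
  refine (Equiv.sum_comp (Equiv.addRight m) _).symm.trans (Finset.sum_congr rfl fun j _ => ?_)
  simp [map_mul, hσ, add_comm m j, mul_assoc]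

/-- The matrix `C` is supported on `E × E`. Its columns `n` and `0` expand `A` and `σ n ∘ A`, so `C
(i + n) 0 = σ n (C i n)`. For `i ≠ 0` in `E` the left side vanishes since `i + n ∉ E`, so only `C 0
n` survives in `A`. Rows treat `B` likewise. -/
theorem exists_scalars_of_sum_mul_eq [DecidableEq G]
    (hli : LinearIndependent F (fun i x => σ i x)) (hσ0 : ∀ x, σ 0 x = x)
    (hσ : ∀ i j x, σ i (σ j x) = σ (i + j) x) {A B : F → F} {L M : G → F → F} {n : G}
    (h : ∀ x y, ∑ j, L j x * σ j y = ∑ i, M i y * σ i x)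
    (hLn : ∀ x, L n x = A x) (hL0 : ∀ x, L 0 x = σ n (A x))
    (hMn : ∀ x, M n x = B x) (hM0 : ∀ x, M 0 x = σ n (B x)) {E : Set G}
    (hLE : ∀ j, j ∉ E → ∀ x, L j x = 0) (hME : ∀ j, j ∉ E → ∀ x, M j x = 0)
    (hE : ∀ i ∈ E, i + n ∈ E → i = 0) :
    ∃ a b, (∀ x, A x = a * x) ∧ (∀ x, B x = b * x) ∧ a = σ n b ∧ b = σ n a := by
  obtain ⟨C, hCL, hCM⟩ := hli.exists_coeff_of_sum_mul_eq h
  have hC1 : ∀ i j, i ∉ E → C i j = 0 := fun i j hi =>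
    coeff_eq_zero hli (fun x => by rw [← hCM, hME i hi]) j
  have hC2 : ∀ i j, j ∉ E → C i j = 0 := fun i j hj =>
    coeff_eq_zero hli (c := fun i => C i j) (fun x => by rw [← hCL, hLE j hj]) i
  have hA : ∀ x, A x = ∑ i, C i n * σ i x := fun x => by rw [← hLn, hCL]
  have hB : ∀ x, B x = ∑ j, C n j * σ j x := fun x => by rw [← hMn, hCM]
  have hsA : ∀ i, C (i + n) 0 = σ n (C i n) := fun i => by
    rw [← one_mul (σ n _)]
    exact coeff_shift hli hσ (d := fun i => C i 0) hA (fun x => by rw [one_mul, ← hL0, hCL]) i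
  have hsB : ∀ j, C 0 (j + n) = σ n (C n j) := fun j => by
    rw [← one_mul (σ n _)]
    exact coeff_shift hli hσ (d := fun j => C 0 j) hB (fun x => by rw [one_mul, ← hM0, hCM]) j
  have hA0 : ∀ i, i ≠ 0 → C i n = 0 := fun i hi => by
    by_cases hiE : i ∈ E
    · exact (map_eq_zero (σ n)).mp (by rw [← hsA]; exact hC1 _ _ fun hin => hi (hE i hiE hin))
    · exact hC1 _ _ hiE
  have hB0 : ∀ j, j ≠ 0 → C n j = 0 := fun j hj => by
    by_cases hjE : j ∈ E
    · exact (map_eq_zero (σ n)).mp (by rw [← hsB]; exact hC2 _ _ fun hjn => hj (hE j hjE hjn))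
    · exact hC2 _ _ hjE
  refine ⟨C 0 n, C n 0, fun x => ?_, fun x => ?_, ?_, ?_⟩
  · rw [hA, Finset.sum_eq_single 0 (fun i _ hi => by rw [hA0 i hi, zero_mul]) (by simp), hσ0]
  · rw [hB, Finset.sum_eq_single 0 (fun i _ hi => by rw [hB0 i hi, zero_mul]) (by simp), hσ0]
  · simpa using hsB 0
  · simpa using hsA 0

end Coefficients

/-! ### The pairs `(A, B)` are scalars fixed by the `q`-th power map. -/

theorem pow_eq_self_of_coprime {F : Type*} [Field F] {q i j : ℕ} (hij : Nat.Coprime i j) {a : F}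
    (hi : a ^ q ^ i = a) (hj : a ^ q ^ j = a) : a ^ q = a := by
  have hper : ∀ k, a ^ q ^ k = a → Function.IsPeriodicPt (fun x : F => x ^ q) k a := fun k hk => by
    rw [Function.IsPeriodicPt, Function.IsFixedPt, pow_iterate]; exact hk
  have := (hper i hi).gcd (hper j hj)
  rw [hij.gcd_eq_one] at this
  exact this

theorem natCast_zmod_eq_cases {N a b : ℕ} (ha : a < 3 * N) (hb : b < 3 * N)
    (hab : (a : ZMod N) = b) :
    a = b ∨ a = b + N ∨ b = a + N ∨ a = b + 2 * N ∨ b = a + 2 * N := by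
  obtain ⟨k, hk⟩ := (Nat.modEq_iff_dvd.mp ((ZMod.natCast_eq_natCast_iff a b N).mp hab))
  have hN : 0 < N := by omega
  have h1 : k < 3 := by by_contra hc; nlinarith
  have h2 : -3 < k := by by_contra hc; nlinarith
  interval_cases k <;> omega

/-- The generic case: `1 < h`. -/
theorem exists_scalar_of_zkwMul_of_one_lt {F : Type*} [Field F] [Finite F] {q h n : ℕ}
    (hq : IsPrimePow q) (hq_odd : Odd q) (hh : Odd h) (hh1 : 1 < h)
    (hn_pos : 0 < n) (hn_lt : n < 3 * h) (hcop : Nat.Coprime h n)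
    (hF : Nat.card F = q ^ (3 * h)) {u : F} (hu : orderOf u = q ^ (3 * h) - 1) {A B : F → F}
    (hAB : ∀ x y, zkwMul q h n u (A x) y = zkwMul q h n u x (B y)) :
    ∃ a, a ^ q = a ∧ ∀ x, A x = a * x := by
  have hq2 : 2 < q := by
    have := hq.one_lt
    obtain ⟨r, rfl⟩ := hq_odd
    omega
  have : NeZero (3 * h) := ⟨by omega⟩
  obtain ⟨σ, hσp, hσ, hli⟩ := exists_zmod_ringHom_pow hq hq2 hF hu
  -- These exclusions, valid as `h > 1`, make the exponents `0, n, h + n, 2h` distinct modulo `3h`.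
  -- With `h` odd they also ensure that adding `n` to a nonzero one leaves the set.
  have hnh : n ≠ h := by rintro rfl; rw [Nat.coprime_self] at hcop; omega
  have hn2h : n ≠ 2 * h := by
    rintro rfl
    have := hcop.eq_one_of_dvd (dvd_mul_left h 2)
    omega
  obtain ⟨m, hm⟩ := hh
  have d1 : ((n : ℕ) : ZMod (3 * h)) ≠ 0 := fun h0 => by
    have := natCast_zmod_eq_cases (by omega) (by omega) (h0.trans Nat.cast_zero.symm); omega
  have d2 : ((h + n : ℕ) : ZMod (3 * h)) ≠ 0 := fun h0 => by
    have := natCast_zmod_eq_cases (by omega) (by omega) (h0.trans Nat.cast_zero.symm); omega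
  have d3 : ((2 * h : ℕ) : ZMod (3 * h)) ≠ 0 := fun h0 => by
    have := natCast_zmod_eq_cases (by omega) (by omega) (h0.trans Nat.cast_zero.symm); omega
  have d4 : ((n : ℕ) : ZMod (3 * h)) ≠ ((h + n : ℕ) : ZMod (3 * h)) := fun h0 => by
    have := natCast_zmod_eq_cases (by omega) (by omega) h0; omega
  have d5 : ((n : ℕ) : ZMod (3 * h)) ≠ ((2 * h : ℕ) : ZMod (3 * h)) := fun h0 => by
    have := natCast_zmod_eq_cases (by omega) (by omega) h0; omega
  have d6 : ((h + n : ℕ) : ZMod (3 * h)) ≠ ((2 * h : ℕ) : ZMod (3 * h)) := fun h0 => by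
    have := natCast_zmod_eq_cases (by omega) (by omega) h0; omega
  have hσ0 : ∀ x, σ 0 x = x := fun x => by simpa using hσp 0 x
  set v := u ^ (q ^ h - 1) with hv
  simp only [zkwMul, ← hv, ← hσp] at hAB
  set N₁ : ZMod (3 * h) := ((n : ℕ) : ZMod (3 * h)) with hN₁
  set N₂ : ZMod (3 * h) := ((h + n : ℕ) : ZMod (3 * h)) with hN₂
  set N₃ : ZMod (3 * h) := ((2 * h : ℕ) : ZMod (3 * h)) with hN₃
  let L : (F → F) → ZMod (3 * h) → F → F := fun A j x =>
    (if j = N₁ then A x else 0) + (if j = 0 then σ N₁ (A x) else 0) +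
    (if j = N₂ then -v * σ N₃ (A x) else 0) + (if j = N₃ then -v * σ N₂ (A x) else 0)
  have hsum : ∀ (A : F → F) x y, ∑ j, L A j x * σ j y =
      A x * σ N₁ y + σ N₁ (A x) * y - v * (σ N₂ y * σ N₃ (A x) + σ N₃ y * σ N₂ (A x)) := by
    intro A x y
    simp only [L, add_mul, ite_mul, zero_mul, Finset.sum_add_distrib, Finset.sum_ite_eq',
      Finset.mem_univ, if_true, hσ0]
    ring
  obtain ⟨a, b, hA, hB, hab, hba⟩ := exists_scalars_of_sum_mul_eq hli hσ0 hσ (A := A) (B := B)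
    (L := L A) (M := L B) (n := N₁) (E := {0, N₁, N₂, N₃})
    (fun x y => by
      rw [hsum, hsum]
      linear_combination hAB x y)
    (fun x => by simp [L, d1, d4, d5]) (fun x => by simp [L, d1.symm, d2.symm, d3.symm])
    (fun x => by simp [L, d1, d4, d5]) (fun x => by simp [L, d1.symm, d2.symm, d3.symm])
    (fun j hj x => by
      simp only [Set.mem_insert_iff, Set.mem_singleton_iff, not_or] at hj
      simp [L, hj])
    (fun j hj x => by
      simp only [Set.mem_insert_iff, Set.mem_singleton_iff, not_or] at hj
      simp [L, hj])
    (by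
      have cast0 : (0 : ZMod (3 * h)) = ((0 : ℕ) : ZMod (3 * h)) := Nat.cast_zero.symm
      intro i hi hin
      simp only [Set.mem_insert_iff, Set.mem_singleton_iff] at hi hin
      rcases hi with rfl | rfl | rfl | rfl
      · rfl
      all_goals
        exfalso
        simp only [hN₁, hN₂, hN₃, cast0, ← Nat.cast_add] at hin
        rcases hin with hin | hin | hin | hin <;>
        · have := natCast_zmod_eq_cases (by omega) (by omega) hin
          omega)
  refine ⟨a, ?_, hA⟩
  have hvn : v ≠ 0 := by
    rw [hv]
    refine pow_ne_zero _ ?_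
    rintro rfl
    rw [orderOf_zero] at hu
    have : 1 < q ^ (3 * h) := Nat.one_lt_pow (by omega) (by omega)
    omega
  -- At `y = 1` the terms without `v` cancel by `a = σ N₁ b` and `b = σ N₁ a`, leaving a relation
  -- between `σ N₂ x` and `σ N₃ x` alone.
  have h1 : ∀ x, ∑ j, ((if j = N₃ then σ N₃ a - σ N₂ b else 0) +
      (if j = N₂ then σ N₂ a - σ N₃ b else 0)) * σ j x = 0 := by
    intro x
    simp only [add_mul, ite_mul, zero_mul, Finset.sum_add_distrib, Finset.sum_ite_eq',
      Finset.mem_univ, if_true]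
    have h2 := hAB x 1
    simp only [hA, hB, map_mul, map_one, one_mul, mul_one, ← hab, ← hba] at h2
    apply mul_left_cancel₀ hvn
    linear_combination -h2
  have h3 := coeff_eq_zero hli h1 N₃
  simp only [if_true, if_neg d6.symm, add_zero] at h3
  have h4 : σ N₂ b = σ (h : ℕ) a := by
    rw [hab, hσ]
    simp [hN₁, hN₂]
  rw [h4, hN₃, hσp, hσp, sub_eq_zero] at h3
  have h5 : a ^ q ^ h = a := by
    rw [← hσp]
    apply (σ (h : ℕ)).injective
    rw [hσp, hσp, ← pow_mul, ← pow_add, ← two_mul, h3]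
  have h6 : a ^ q ^ (2 * n) = a := by
    rw [two_mul, pow_add, pow_mul, ← hσp n a, ← hσp n, ← hN₁, ← hba, ← hab]
  refine pow_eq_self_of_coprime (Nat.Coprime.mul_right ?_ hcop) h5 h6
  rw [Nat.coprime_two_right]
  exact ⟨m, hm⟩

/-- The twisted field case `h = 1`, `n = 2`. -/
theorem exists_scalar_of_zkwMul_one_two {F : Type*} [Field F] [Finite F] {q : ℕ}
    (hq : IsPrimePow q) (hq_odd : Odd q) (hF : Nat.card F = q ^ 3) {u : F}
    (hu : orderOf u = q ^ 3 - 1) {A B : F → F}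
    (hAB : ∀ x y, zkwMul q 1 2 u (A x) y = zkwMul q 1 2 u x (B y)) :
    ∃ a, a ^ q = a ∧ ∀ x, A x = a * x := by
  have hq2 : 2 < q := by
    have := hq.one_lt
    obtain ⟨r, rfl⟩ := hq_odd
    omega
  obtain ⟨σ, hσp, hσ, hli⟩ := exists_zmod_ringHom_pow hq hq2 hF hu
  have hσ0 : ∀ x, σ 0 x = x := fun x => by simpa using hσp 0 x
  have hσ2 : ∀ x, x ^ q ^ 2 = σ 2 x := fun x => (hσp 2 x).symm
  have hv : 1 - u ^ (q - 1) ≠ 0 := fun h0 => by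
    have h1 := orderOf_dvd_of_pow_eq_one (sub_eq_zero.mp h0).symm
    rw [hu] at h1
    have h2 := Nat.le_of_dvd (by omega) h1
    have h3 : q < q ^ 3 := by nlinarith [pow_succ q 2, sq q]
    omega
  -- As `h + n = 3`, the power `q^(h+n)` acts trivially and the product collapses to `(1 - v) (x
  -- y^(q²) + y x^(q²))`.
  simp only [zkwMul, Nat.reduceAdd, mul_one, pow_one, pow_pow_card_exponent hF, hσ2] at hAB
  let L : (F → F) → ZMod 3 → F → F := fun A j x =>
    (if j = 2 then A x else 0) + (if j = 0 then σ 2 (A x) else 0)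
  have hsum : ∀ (A : F → F) x y, ∑ j, L A j x * σ j y = A x * σ 2 y + σ 2 (A x) * y := by
    intro A x y
    simp only [L, add_mul, ite_mul, zero_mul, Finset.sum_add_distrib, Finset.sum_ite_eq',
      Finset.mem_univ, if_true, hσ0]
  have d : (2 : ZMod 3) ≠ 0 := by decide
  obtain ⟨a, b, hA, -, hab, hba⟩ := exists_scalars_of_sum_mul_eq hli hσ0 hσ (A := A) (B := B)
    (L := L A) (M := L B) (n := 2) (E := {0, 2})
    (fun x y => by
      rw [hsum, hsum]
      apply mul_left_cancel₀ hv
      linear_combination hAB x y)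
    (fun x => by simp [L, d]) (fun x => by simp [L, d.symm])
    (fun x => by simp [L, d]) (fun x => by simp [L, d.symm])
    (fun j hj x => by
      simp only [Set.mem_insert_iff, Set.mem_singleton_iff, not_or] at hj
      simp [L, hj])
    (fun j hj x => by
      simp only [Set.mem_insert_iff, Set.mem_singleton_iff, not_or] at hj
      simp [L, hj])
    (by
      simp only [Set.mem_insert_iff, Set.mem_singleton_iff]
      decide)
  refine ⟨a, pow_eq_self_of_coprime (i := 3) (j := 4) (by norm_num)
    (pow_pow_card_exponent hF a) ?_, hA⟩
  rw [show 4 = 2 + 2 by rfl, pow_add, pow_mul, hσ2, hσ2, ← hba, ← hab]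

theorem three_ne_zero_of_not_dvd_card {F : Type*} [Field F] (hF : ¬ 3 ∣ Nat.card F) :
    (3 : F) ≠ 0 := by
  intro h3
  have h4 : addOrderOf (1 : F) ∣ 3 := addOrderOf_dvd_of_nsmul_eq_zero (by simpa using h3)
  have h5 : addOrderOf (1 : F) ∣ Nat.card F := addOrderOf_dvd_natCard 1
  rcases (Nat.dvd_prime Nat.prime_three).mp h4 with h6 | h6
  · exact one_ne_zero (AddMonoid.addOrderOf_eq_one_iff.mp h6)
  · exact hF (h6 ▸ h5)

/-- Taking the norm (the product over the orbit of `φ`) gives `N(c) = -8 N(c)`, that is `9 N(c) =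
0`. -/
theorem eq_zero_of_eq_neg_two_mul {F : Type*} [Field F] (h3 : (3 : F) ≠ 0) (φ : F →+* F)
    (hφ : ∀ x, φ (φ (φ x)) = x) {v c : F} (hv : v * φ v * φ (φ v) = 1)
    (hc : c = -2 * v * φ c) : c = 0 := by
  by_contra hc0
  have h1 := congrArg φ hc
  have h2 := congrArg φ h1
  simp only [map_mul, map_neg, map_ofNat, hφ] at h1 h2
  have hc1 : φ c ≠ 0 := (map_ne_zero φ).mpr hc0
  have hc2 : φ (φ c) ≠ 0 := (map_ne_zero φ).mpr hc1
  have h9 : (3 : F) * 3 = 0 := by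
    apply mul_left_cancel₀ (mul_ne_zero (mul_ne_zero hc0 hc1) hc2)
    have : c * φ c * φ (φ c) =
        (-2 * v * φ c) * (-2 * φ v * φ (φ c)) * (-2 * φ (φ v) * c) := by
      rw [← hc, ← h1, ← h2]
    linear_combination this - 8 * (c * φ c * φ (φ c)) * hv
  exact h3 (mul_self_eq_zero.mp h9)

/-- The case `h = n = 1`. -/
theorem exists_scalar_of_zkwMul_one_one {F : Type*} [Field F] [Finite F] {q : ℕ}
    (hq : IsPrimePow q) (hq_odd : Odd q) (hq1 : q ≡ 1 [MOD 3]) (hF : Nat.card F = q ^ 3) {u : F}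
    (hu : orderOf u = q ^ 3 - 1) {A B : F → F}
    (hAB : ∀ x y, zkwMul q 1 1 u (A x) y = zkwMul q 1 1 u x (B y)) :
    ∃ a, a ^ q = a ∧ ∀ x, A x = a * x := by
  have hq2 : 2 < q := by
    have := hq.one_lt
    obtain ⟨r, rfl⟩ := hq_odd
    omega
  obtain ⟨σ, hσp, hσ, hli⟩ := exists_zmod_ringHom_pow hq hq2 hF hu
  have hσ0 : ∀ x, σ 0 x = x := fun x => by simpa using hσp 0 x
  have hσ1 : ∀ x, x ^ q = σ 1 x := fun x => by simpa using (hσp 1 x).symm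
  have hσ2 : ∀ x, x ^ q ^ 2 = σ 2 x := fun x => (hσp 2 x).symm
  set v := u ^ (q - 1) with hv
  have hvN : v * v ^ q * v ^ q ^ 2 = 1 := by
    have : (q - 1) * (1 + q + q ^ 2) = q ^ 3 - 1 := by
      obtain ⟨r, rfl⟩ : ∃ r, q = r + 1 := ⟨q - 1, by omega⟩
      rw [Nat.add_sub_cancel]
      apply Nat.eq_sub_of_add_eq
      ring
    rw [← pow_succ', ← pow_add, hv, ← pow_mul, show q + 1 + q ^ 2 = 1 + q + q ^ 2 by ring, this,
      ← hu, pow_orderOf_eq_one]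
  -- Since `h + n = 2h = 2`, the twisted terms merge into `-2 v x^(q²) y^(q²)`. The support is all
  -- of `ZMod 3`, so the unwanted coefficients `C 1 1` and `C 2 1` must be removed by the norm
  -- argument.
  simp only [zkwMul, Nat.reduceAdd, mul_one, pow_one, ← hv, hσ2, hσ1] at hAB
  let L : (F → F) → ZMod 3 → F → F := fun A j x =>
    (if j = 1 then A x else 0) + (if j = 0 then σ 1 (A x) else 0) +
      (if j = 2 then -2 * v * σ 2 (A x) else 0)
  have hsum : ∀ (A : F → F) x y, ∑ j, L A j x * σ j y =
      A x * σ 1 y + σ 1 (A x) * y + (-2 * v * σ 2 (A x)) * σ 2 y := by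
    intro A x y
    simp only [L, add_mul, ite_mul, zero_mul, Finset.sum_add_distrib, Finset.sum_ite_eq',
      Finset.mem_univ, if_true, hσ0]
  have d1 : (1 : ZMod 3) ≠ 0 := by decide
  have d2 : (2 : ZMod 3) ≠ 0 := by decide
  have d3 : (1 : ZMod 3) ≠ 2 := by decide
  have hL0 : ∀ A x, L A 0 x = σ 1 (A x) := fun A x => by simp [L, d1.symm, d2.symm]
  have hL1 : ∀ A x, L A 1 x = A x := fun A x => by simp [L, d1, d3]
  have hL2 : ∀ A x, L A 2 x = -2 * v * σ 2 (A x) := fun A x => by simp [L, d3.symm, d2]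
  obtain ⟨C, hCL, hCM⟩ := hli.exists_coeff_of_sum_mul_eq (L := L A) (M := L B) fun x y => by
    rw [hsum, hsum]
    linear_combination hAB x y
  have hA : ∀ x, A x = ∑ i, C i 1 * σ i x := fun x => by rw [← hL1 A, hCL]
  have hB : ∀ x, B x = ∑ j, C 1 j * σ j x := fun x => by rw [← hL1 B, hCM]
  have s1 : ∀ i, C (i + 1) 0 = 1 * σ 1 (C i 1) := coeff_shift hli hσ (d := fun i => C i 0) hA
    fun x => by rw [one_mul, ← hL0 A, hCL]
  have s2 : ∀ j, C 0 (j + 1) = 1 * σ 1 (C 1 j) := coeff_shift hli hσ hB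
    fun x => by rw [one_mul, ← hL0 B, hCM]
  have s3 : ∀ j, C 2 (j + 2) = -2 * v * σ 2 (C 1 j) := coeff_shift hli hσ hB
    fun x => by rw [← hL2 B, hCM]
  simp only [one_mul] at s1 s2
  have h3 : (3 : F) ≠ 0 := three_ne_zero_of_not_dvd_card fun h => by
    rw [hF] at h
    have := Nat.prime_three.dvd_of_dvd_pow h
    rw [Nat.ModEq] at hq1
    omega
  have hcube : ∀ i : ZMod 3, i + i + i = 0 := by decide
  have hσ3 : ∀ i x, σ i (σ i (σ i x)) = x := fun i x => by rw [hσ, hσ, hcube, hσ0]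
  have z11 : C 1 1 = 0 := by
    refine (map_eq_zero (σ 1)).mp (eq_zero_of_eq_neg_two_mul h3 (σ 1) (hσ3 1) (v := v) ?_ ?_)
    · rw [← hvN, hσ, hσ1, hσ2]; rfl
    · rw [hσ]
      exact (s1 1).symm.trans (s3 1)
  have z21 : C 2 1 = 0 := by
    have e : C 2 1 = C 1 2 := (σ 1).injective ((s1 2).symm.trans (s2 2))
    refine eq_zero_of_eq_neg_two_mul h3 (σ 2) (hσ3 2) (v := v) ?_ ?_
    · rw [← hvN, hσ, hσ1, hσ2, mul_right_comm]; rfl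
    · nth_rw 2 [e]
      exact s3 2
  have h0 : C 0 1 = σ 1 (C 1 0) := s2 0
  have h1 : C 1 0 = σ 1 (C 0 1) := s1 0
  refine ⟨C 0 1, pow_eq_self_of_coprime (i := 3) (j := 2) (by norm_num)
    (pow_pow_card_exponent hF _) ?_, fun x => ?_⟩
  · rw [sq, pow_mul, hσ1, hσ1, ← h1, ← h0]
  · rw [hA, Finset.sum_eq_single 0 (fun i _ hi => ?_) (by simp), hσ0]
    have : i = 1 ∨ i = 2 := by revert i; decide
    rcases this with rfl | rfl
    · rw [z11, zero_mul]
    · rw [z21, zero_mul]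

theorem exists_scalar_of_zkwMul {F : Type*} [Field F] [Finite F] {q h n : ℕ}
    (hq : IsPrimePow q) (hq_odd : Odd q) (hh : Odd h)
    (hn_pos : 0 < n) (hn_lt : n < 3 * h) (hcop : Nat.Coprime h n)
    (hcong : 3 ∣ h + n ∨ q ≡ 1 [MOD 3])
    (hF : Nat.card F = q ^ (3 * h)) {u : F} (hu : orderOf u = q ^ (3 * h) - 1) {A B : F → F}
    (hAB : ∀ x y, zkwMul q h n u (A x) y = zkwMul q h n u x (B y)) :
    ∃ a, a ^ q = a ∧ ∀ x, A x = a * x := by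
  have hh0 := hh.pos
  rcases (show h = 1 ∨ 1 < h by omega) with rfl | hh1
  · rw [mul_one] at hF hu hn_lt
    obtain rfl | rfl : n = 1 ∨ n = 2 := by omega
    · exact exists_scalar_of_zkwMul_one_one hq hq_odd (hcong.resolve_left (by omega)) hF hu hAB
    · exact exists_scalar_of_zkwMul_one_two hq hq_odd hF hu hAB
  · exact exists_scalar_of_zkwMul_of_one_lt hq hq_odd hh hh1 hn_pos hn_lt hcop hF hu hAB

/-! ### Bilinearity over the scalars and the main theorem. -/

theorem zkwMul_mul_right {F : Type*} [Field F] {q : ℕ} (h n : ℕ) (u : F) {a : F} (ha : a ^ q = a)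
    (x y : F) : zkwMul q h n u x (a * y) = a * zkwMul q h n u x y := by
  have key : ∀ i, a ^ q ^ i = a := fun i => by
    induction i with
    | zero => simp
    | succ i ih => rw [pow_succ, pow_mul, ih, ha]
  simp only [zkwMul, mul_pow, key]
  ring

theorem mainTheorem3 {F : Type*} [Field F] [Finite F] (q h n : ℕ)
    (hq : IsPrimePow q) (hq_odd : Odd q) (hh : Odd h)
    (hn_pos : 0 < n) (hn_lt : n < 3 * h) (hcop : Nat.Coprime h n)
    (hcong : 3 ∣ h + n ∨ q ≡ 1 [MOD 3])
    (hF : Nat.card F = q ^ (3 * h))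
    (u : F) (hu : orderOf u = q ^ (3 * h) - 1) :
    IsPresemifield (zkwMul q h n u) ∧
    (∃ m : F → F → F, IsSemifield m ∧ IsIsotopic (zkwMul q h n u) m) ∧
    ∀ (S : Type*) [AddCommGroup S] (m : S → S → S),
      IsSemifield m → IsIsotopic (zkwMul q h n u) m →
        (middleNucleus m).ncard = q ∧ (semifieldCenter m).ncard = q := by
  have hN : 3 * h ≠ 0 := by have := hh.pos; omega
  have hpre : IsPresemifield (zkwMul q h n u) :=
    isPresemifield_zkwMul hq hq_odd hh hcop hcong hF hu
  refine ⟨hpre, hpre.exists_isSemifield_isIsotopic, fun S _ m hm hiso => ?_⟩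
  rw [← ncard_setOf_pow_eq_self hq.one_lt hN hu]
  refine ncard_middleNucleus_and_semifieldCenter hm hiso (fun a ha x y => ?_)
    (fun a ha => zkwMul_mul_right h n u ha) fun A B hAB =>
      exists_scalar_of_zkwMul hq hq_odd hh hn_pos hn_lt hcop hcong hF hu hAB
  rw [zkwMul_comm, zkwMul_mul_right h n u ha, zkwMul_comm]
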